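/- All graphs are finite and simple. For a graph $G$ on $n$ vertices with adjacency matrix $A(G)$ and diagonal matrix of vertex degrees $D(G)$, let $q_1,\dots,q_n$ be the eigenvalues, counted with multiplicity, of the signless Laplacian matrix $Q(G)=D(G)+A(G)$, and let $SLEE(G)=\sum_{i=1}^{n}e^{q_i}$ be its signless Laplacian Estrada index. A cut edge of a connected graph is an edge whose removal disconnects the graph. For integers $n$ and $r$ with $0\le r\le n-3$, let $G_{n,r}$ be the graph on $n$ vertices obtained from the complete graph $K_{n-r}$ by attaching $r$ pendent vertices, all to the same vertex of $K_{n-r}$. Theorem. Let $n$ and $r$ be integers with $0\le r\le n-3$, and let $G$ be a connected graph on $n$ vertices with exactly $r$ cut edges. Then $SLEE(G)\le SLEE(G_{n,r})$, with equality if and only if $G$ is isomorphic to $G_{n,r}$. -/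

import Mathlib

namespace SimpleGraph

section SignlessLaplacian

variable {V : Type*} [Fintype V] [DecidableEq V] (G : SimpleGraph V) [DecidableRel G.Adj]

/-- The signless Laplacian matrix `Q(G) = D(G) + A(G)` over the reals. -/
def signlessLapMatrix : Matrix V V ℝ := G.degMatrix ℝ + G.adjMatrix ℝ

theorem isHermitian_signlessLapMatrix : G.signlessLapMatrix.IsHermitian :=
  (G.isHermitian_degMatrix ℝ).add (G.isHermitian_adjMatrix ℝ)

/-- The signless Laplacian Estrada index `SLEE(G) = ∑ i, exp (q i)`, where the `q i` are the
eigenvalues of `Q(G)`, listed with multiplicity. -/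
noncomputable def signlessLapEstradaIndex : ℝ :=
  ∑ i, Real.exp (G.isHermitian_signlessLapMatrix.eigenvalues i)

end SignlessLaplacian

/-- The set of cut edges of a graph. -/
def cutEdges {V : Type*} (G : SimpleGraph V) : Set (Sym2 V) :=
  {e | e ∈ G.edgeSet ∧ G.IsBridge e}

/-- The graph `G_{n,r}` (for `r < n`), on the vertices `0, …, n - 1`: the vertices `i` with
`i + r < n` (that is, `0, …, n - r - 1`) form a complete graph `K_{n-r}`, and each of the remaining
`r` vertices is adjacent to the vertex `0` only. -/
def completeWithPendents (n r : ℕ) : SimpleGraph (Fin n) where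
  Adj i j := i ≠ j ∧
    ((i.val + r < n ∧ j.val + r < n) ∨
      (i.val = 0 ∧ n ≤ j.val + r) ∨ (j.val = 0 ∧ n ≤ i.val + r))
  symm := ⟨by
    rintro i j ⟨hne, h⟩
    refine ⟨hne.symm, ?_⟩
    tauto⟩
  loopless := ⟨fun _ h => h.1 rfl⟩

instance (n r : ℕ) : DecidableRel (completeWithPendents n r).Adj := fun i j =>
  inferInstanceAs (Decidable (i ≠ j ∧
    ((i.val + r < n ∧ j.val + r < n) ∨
      (i.val = 0 ∧ n ≤ j.val + r) ∨ (j.val = 0 ∧ n ≤ i.val + r))))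

end SimpleGraph

/-! The index equals ∑ tr(Q^k)/k!, so it suffices to compare traces of powers. If, in some
orthonormal basis, the entries of one matrix dominate the absolute values of those of another, all
these traces compare, and a strict entry shows at k = 2. In the standard basis this says that adding
an edge raises the index. With e_a, e_b replaced by (e_a ± e_b)/√2, it says that the Kelmans
transformation from b to a raises it when each of a, b has a neighbour, other than a and b, not
shared with the other.

The extremal problem is solved in the finite class of graphs with at least r bridges, recorded as
cuts with a single crossing edge. For a maximizer in this class, transforming along a bridge shows
that the bridge is pendent, transforming two centres shows that all pendent edges share one centre,
and adding edges shows that the other vertices form a clique. Hence it is G_{n,r}, which gives the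
bound; a graph attaining the bound is itself a maximizer, which gives the equality case. -/

namespace Matrix

/-! ### Traces of powers and entrywise comparison. -/

section ExpEigenvalues

variable {ι : Type*} [Fintype ι] [DecidableEq ι]

theorem IsHermitian.trace_pow_eq_sum {M : Matrix ι ι ℝ} (hM : M.IsHermitian) (k : ℕ) :
    (M ^ k).trace = ∑ i, hM.eigenvalues i ^ k := by
  conv_lhs => rw [hM.spectral_theorem, ← map_pow, Unitary.conjStarAlgAut_apply,
    Matrix.trace_mul_comm, ← mul_assoc]
  simp [Matrix.diagonal_pow, Matrix.trace_diagonal]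

/-- Trades eigenvalues for traces, which can be computed in any basis. -/
theorem IsHermitian.hasSum_trace_pow {M : Matrix ι ι ℝ} (hM : M.IsHermitian) :
    HasSum (fun k : ℕ => (M ^ k).trace / k.factorial) (∑ i, Real.exp (hM.eigenvalues i)) := by
  simp only [hM.trace_pow_eq_sum, Finset.sum_div]
  refine hasSum_sum fun i _ => ?_
  rw [Real.exp_eq_exp_ℝ]
  exact NormedSpace.expSeries_div_hasSum_exp (hM.eigenvalues i)

theorem abs_pow_apply_le {B C : Matrix ι ι ℝ} (h : ∀ x y, |B x y| ≤ C x y) (k : ℕ) (x y : ι) :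
    |(B ^ k) x y| ≤ (C ^ k) x y := by
  induction k generalizing y with
  | zero => by_cases hxy : x = y <;> simp [hxy]
  | succ k ih =>
    rw [pow_succ, pow_succ, Matrix.mul_apply, Matrix.mul_apply]
    refine (Finset.abs_sum_le_sum_abs _ _).trans (Finset.sum_le_sum fun z _ => ?_)
    rw [abs_mul]
    exact mul_le_mul (ih z) (h z y) (abs_nonneg _) ((abs_nonneg _).trans (ih z))

theorem conj_pow_trace {H : Matrix ι ι ℝ} (hH : H * H = 1) (M : Matrix ι ι ℝ) (k : ℕ) :
    ((H * M * H) ^ k).trace = (M ^ k).trace := by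
  have : (H * M * H) ^ k = H * M ^ k * H := by
    induction k with
    | zero => simp [hH]
    | succ k ih =>
      rw [pow_succ, ih, pow_succ]
      calc H * M ^ k * H * (H * M * H) = H * M ^ k * (H * H) * M * H := by
            simp only [mul_assoc]
        _ = _ := by rw [hH]; simp only [mul_assoc, one_mul]
  rw [this, Matrix.trace_mul_comm, ← mul_assoc, hH, one_mul]

/-- If, in the coordinates given by a symmetric involution `H`, the entries of `N` dominate the
absolute values of those of `M`, strictly somewhere, then `tr (exp M) < tr (exp N)`. -/
theorem IsHermitian.sum_exp_eigenvalues_lt {M N H : Matrix ι ι ℝ} (hM : M.IsHermitian)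
    (hN : N.IsHermitian) (hH : H * H = 1) (hHt : H.transpose = H)
    (hle : ∀ x y, |(H * M * H) x y| ≤ (H * N * H) x y)
    (hlt : ∃ x y, |(H * M * H) x y| < (H * N * H) x y) :
    ∑ i, Real.exp (hM.eigenvalues i) < ∑ i, Real.exp (hN.eigenvalues i) := by
  have hsymm : ∀ {K : Matrix ι ι ℝ}, K.IsHermitian → ∀ x y, (H * K * H) x y = (H * K * H) y x := by
    intro K hK x y
    have : (H * K * H).transpose = H * K * H := by
      have hKt : K.transpose = K := by simpa [Matrix.IsHermitian] using hK
      simp [Matrix.transpose_mul, hHt, hKt, mul_assoc]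
    exact congrFun (congrFun this y) x
  have hsq : ∀ {K : Matrix ι ι ℝ}, K.IsHermitian →
      (K ^ 2).trace = ∑ x, ∑ y, (H * K * H) x y ^ 2 := by
    intro K hK
    rw [← conj_pow_trace hH K 2, pow_two, Matrix.trace]
    refine Finset.sum_congr rfl fun x _ => ?_
    rw [Matrix.diag_apply, Matrix.mul_apply]
    refine Finset.sum_congr rfl fun y _ => ?_
    rw [hsymm hK y x, pow_two]
  have hentry : ∀ x y, (H * M * H) x y ^ 2 ≤ (H * N * H) x y ^ 2 := fun x y =>
    sq_le_sq' (by linarith [neg_abs_le ((H * M * H) x y), hle x y])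
      ((le_abs_self _).trans (hle x y))
  -- For a symmetric matrix the trace of the square is the sum of all squared entries, so k = 2
  -- detects a strict inequality at any entry.
  refine hasSum_lt (i := 2) (fun k => ?_) ?_ hM.hasSum_trace_pow hN.hasSum_trace_pow
  · refine div_le_div_of_nonneg_right ?_ (by positivity)
    rw [← conj_pow_trace hH M, ← conj_pow_trace hH N]
    exact Finset.sum_le_sum fun x _ => (le_abs_self _).trans (abs_pow_apply_le hle k x x)
  · refine div_lt_div_of_pos_right ?_ (by positivity)
    rw [hsq hM, hsq hN]
    obtain ⟨x, y, hxy⟩ := hlt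
    refine Finset.sum_lt_sum (fun x _ => Finset.sum_le_sum fun y _ => hentry x y)
      ⟨x, Finset.mem_univ _, Finset.sum_lt_sum (fun y _ => hentry x y) ⟨y, Finset.mem_univ _, ?_⟩⟩
    rw [← sq_abs ((H * M * H) x y)]
    exact pow_lt_pow_left₀ hxy (abs_nonneg _) two_ne_zero

theorem IsHermitian.sum_exp_eigenvalues_submatrix {κ : Type*} [Fintype κ] [DecidableEq κ]
    {M : Matrix ι ι ℝ} {N : Matrix κ κ ℝ} (hM : M.IsHermitian) (hN : N.IsHermitian) (e : κ ≃ ι)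
    (h : N = M.submatrix e e) :
    ∑ i, Real.exp (hN.eigenvalues i) = ∑ i, Real.exp (hM.eigenvalues i) := by
  refine hN.hasSum_trace_pow.unique ?_
  convert hM.hasSum_trace_pow using 3 with k
  have : N ^ k = (M ^ k).submatrix e e := by
    rw [h]
    exact (map_pow (Matrix.reindexAlgEquiv ℝ ℝ e.symm) M k).symm
  rw [this]
  exact Fintype.sum_equiv e _ _ fun _ => rfl

/-- The reflection that replaces the basis vectors at `a` and `b` by their normalized sum and
difference. -/
noncomputable def pairReflection (a b : ι) : Matrix ι ι ℝ := fun x =>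
  if x = a then (√2)⁻¹ • (Pi.single a 1 + Pi.single b 1)
  else if x = b then (√2)⁻¹ • (Pi.single a 1 - Pi.single b 1) else Pi.single x 1

theorem pairReflection_mul_apply (a b : ι) (M : Matrix ι ι ℝ) (x y : ι) :
    (pairReflection a b * M) x y =
      if x = a then (√2)⁻¹ * (M a y + M b y)
      else if x = b then (√2)⁻¹ * (M a y - M b y) else M x y := by
  rw [Matrix.mul_apply, pairReflection]
  split_ifs <;>
    simp [Pi.single_apply, add_mul, sub_mul, mul_add, mul_sub, Finset.sum_add_distrib,
      Finset.sum_sub_distrib]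

theorem transpose_pairReflection {a b : ι} (hab : a ≠ b) :
    (pairReflection a b).transpose = pairReflection a b := by
  ext x y
  by_cases hxa : x = a <;> by_cases hxb : x = b <;> by_cases hya : y = a <;>
    by_cases hyb : y = b <;> by_cases hxy : x = y <;>
    simp_all [pairReflection, eq_comm]

theorem inv_sqrt_two_mul_self : (√2)⁻¹ * (√2)⁻¹ = (1 / 2 : ℝ) := by
  rw [← mul_inv, Real.mul_self_sqrt (by norm_num)]
  norm_num

theorem pairReflection_mul_self {a b : ι} (hab : a ≠ b) :
    pairReflection a b * pairReflection a b = 1 := by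
  have h := inv_sqrt_two_mul_self
  ext x y
  rw [pairReflection_mul_apply]
  by_cases hxa : x = a <;> by_cases hxb : x = b <;> by_cases hya : y = a <;>
    by_cases hyb : y = b <;> by_cases hxy : x = y <;>
    simp_all [pairReflection, Matrix.one_apply, eq_comm] <;> linarith

theorem mul_pairReflection_apply {a b : ι} (hab : a ≠ b) (M : Matrix ι ι ℝ) (x y : ι) :
    (M * pairReflection a b) x y =
      if y = a then (√2)⁻¹ * (M x a + M x b)
      else if y = b then (√2)⁻¹ * (M x a - M x b) else M x y := by
  have h : (M * pairReflection a b) x y = (pairReflection a b * M.transpose) y x := by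
    conv_rhs => rw [← transpose_pairReflection hab, ← Matrix.transpose_mul]
    rfl
  rw [h, pairReflection_mul_apply]
  rfl

end ExpEigenvalues

end Matrix

/-! ### Comparison in sum and difference coordinates. -/

namespace Matrix

variable {ι : Type*} [Fintype ι] [DecidableEq ι]

/-- In the reflected basis only the entries involving the difference vector can change, and those
off the diagonal can only grow in absolute value. `hdom` makes its diagonal entry nonnegative;
strictness sits at (a, b), where the entry is half the difference of the two diagonal entries. -/
theorem IsHermitian.sum_exp_eigenvalues_lt_of_pair {M N : Matrix ι ι ℝ} (hM : M.IsHermitian)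
    (hN : N.IsHermitian) {a b : ι} (hab : a ≠ b) (hM0 : ∀ x y, 0 ≤ M x y)
    (hrest : ∀ x y, x ≠ a → x ≠ b → y ≠ a → y ≠ b → N x y = M x y)
    (hadd : ∀ w, w ≠ a → w ≠ b → N a w + N b w = M a w + M b w)
    (hsub : ∀ w, w ≠ a → w ≠ b → |M a w - M b w| ≤ N a w - N b w)
    (hpair : N a b = M a b) (hdiag : N a a + N b b = M a a + M b b)
    (hlt : |M a a - M b b| < N a a - N b b) (hdom : 2 * M a b ≤ M a a + M b b) :
    ∑ i, Real.exp (hM.eigenvalues i) < ∑ i, Real.exp (hN.eigenvalues i) := by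
  have hMs : ∀ x y, M x y = M y x := fun x y => by simpa using (hM.apply y x)
  have hNs : ∀ x y, N x y = N y x := fun x y => by simpa using (hN.apply y x)
  have hs : (0 : ℝ) < (√2)⁻¹ := by positivity
  have hs2 := inv_sqrt_two_mul_self
  have hentry : ∀ (K : Matrix ι ι ℝ) (x y : ι),
      (pairReflection a b * K * pairReflection a b) x y = _ := fun K x y =>
    mul_pairReflection_apply hab _ x y
  simp only [pairReflection_mul_apply] at hentry
  have hab_entry : ∀ K : Matrix ι ι ℝ, (∀ x y, K x y = K y x) →
      (pairReflection a b * K * pairReflection a b) a b = 1 / 2 * (K a a - K b b) := by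
    intro K hK
    rw [hentry, if_neg hab.symm, if_pos rfl, if_pos rfl, if_pos rfl, hK b a, ← hs2]
    ring
  refine hM.sum_exp_eigenvalues_lt hN (pairReflection_mul_self hab) (transpose_pairReflection hab)
    (fun x y => ?_) ⟨a, b, ?_⟩
  · by_cases hxa : x = a <;> by_cases hya : y = a
    · subst hxa hya
      rw [hentry, hentry]
      simp only [if_true, ← mul_add, ← mul_assoc, hs2]
      rw [abs_of_nonneg (by have := hM0 y y; have := hM0 y b; have := hM0 b y
                            have := hM0 b b; positivity), hNs b y, hMs b y]
      linarith
    · subst hxa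
      by_cases hyb : y = b
      · subst hyb
        rw [hab_entry M hMs, hab_entry N hNs, abs_mul, abs_of_pos (by norm_num : (0:ℝ) < 1 / 2)]
        linarith
      · rw [hentry, hentry]
        simp only [if_true, if_neg hya, if_neg hyb]
        rw [hadd y hya hyb, abs_of_nonneg (mul_nonneg hs.le (add_nonneg (hM0 _ _) (hM0 _ _)))]
    · subst hya
      by_cases hxb : x = b
      · subst hxb
        rw [hentry, hentry]
        simp only [if_true, if_neg hxa, ← mul_add, ← mul_assoc, hs2]
        rw [hNs x y, hMs x y, sub_add_sub_cancel, sub_add_sub_cancel, abs_mul,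
          abs_of_pos (by norm_num : (0:ℝ) < 1 / 2)]
        linarith
      · rw [hentry, hentry]
        simp only [if_true, if_neg hxa, if_neg hxb]
        rw [hNs x y, hNs x b, hMs x y, hMs x b, hadd x hxa hxb,
          abs_of_nonneg (mul_nonneg hs.le (add_nonneg (hM0 _ _) (hM0 _ _)))]
    · by_cases hxb : x = b <;> by_cases hyb : y = b
      · subst hxb hyb
        rw [hentry, hentry]
        simp only [if_true, if_neg hxa, ← mul_sub, ← mul_assoc, hs2]
        rw [hNs y a, hMs y a, abs_of_nonneg (by linarith)]
        linarith
      · subst hxb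
        rw [hentry, hentry]
        simp only [if_true, if_neg hxa, if_neg hya, if_neg hyb]
        rw [abs_mul, abs_of_pos hs]
        exact mul_le_mul_of_nonneg_left (hsub y hya hyb) hs.le
      · subst hyb
        rw [hentry, hentry]
        simp only [if_true, if_neg hxa, if_neg hxb, if_neg hya]
        rw [hNs x a, hNs x y, hMs x a, hMs x y, abs_mul, abs_of_pos hs]
        exact mul_le_mul_of_nonneg_left (hsub x hxa hxb) hs.le
      · rw [hentry, hentry]
        simp only [if_neg hxa, if_neg hxb, if_neg hya, if_neg hyb]
        rw [hrest x y hxa hxb hya hyb, abs_of_nonneg (hM0 _ _)]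
  · rw [hab_entry M hMs, hab_entry N hNs, abs_mul, abs_of_pos (by norm_num : (0:ℝ) < 1 / 2)]
    linarith

end Matrix

namespace SimpleGraph

/-! ### The Kelmans transformation. -/

section Kelmans

/-- The Kelmans transformation: every neighbour of `b` that is neither `a` nor adjacent to `a`
is disconnected from `b` and joined to `a` instead. -/
def kelmans {V : Type*} (G : SimpleGraph V) (a b : V) : SimpleGraph V :=
  fromRel fun x y =>
    (x ≠ a ∧ x ≠ b ∧ y ≠ a ∧ y ≠ b ∧ G.Adj x y) ∨ (x = a ∧ y = b ∧ G.Adj a b) ∨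
      (x = a ∧ y ≠ a ∧ y ≠ b ∧ (G.Adj a y ∨ G.Adj b y)) ∨
      (x = b ∧ y ≠ a ∧ y ≠ b ∧ G.Adj a y ∧ G.Adj b y)

variable {V : Type*} {G : SimpleGraph V} {a b : V}

theorem kelmans_adj_of_ne {x y : V} (hxa : x ≠ a) (hxb : x ≠ b) (hya : y ≠ a) (hyb : y ≠ b) :
    (G.kelmans a b).Adj x y ↔ G.Adj x y := by
  simp only [kelmans, fromRel_adj, hxa, hxb, hya, hyb, G.adj_comm y x]
  have : G.Adj x y → x ≠ y := fun h => h.ne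
  simp
  tauto

theorem kelmans_adj_left (hab : a ≠ b) {w : V} (hwa : w ≠ a) (hwb : w ≠ b) :
    (G.kelmans a b).Adj a w ↔ G.Adj a w ∨ G.Adj b w := by
  simp [kelmans, hab, hwa, hwb, hwa.symm]

theorem kelmans_adj_right (hab : a ≠ b) {w : V} (hwa : w ≠ a) (hwb : w ≠ b) :
    (G.kelmans a b).Adj b w ↔ G.Adj a w ∧ G.Adj b w := by
  simp [kelmans, hab.symm, hwa, hwb, hwb.symm]

theorem kelmans_adj_pair (hab : a ≠ b) : (G.kelmans a b).Adj a b ↔ G.Adj a b := by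
  simp [kelmans, hab, hab.symm]

end Kelmans

/-! ### Operations that raise the index. -/

section Spectral

variable {V : Type*} [Fintype V] [DecidableEq V]

theorem signlessLapMatrix_apply (G : SimpleGraph V) [DecidableRel G.Adj] (x y : V) :
    G.signlessLapMatrix x y =
      if x = y then ∑ z, G.adjMatrix ℝ x z else G.adjMatrix ℝ x y := by
  have hdeg : (G.degree x : ℝ) = ∑ z, G.adjMatrix ℝ x z := by
    simp [adjMatrix_apply, ← card_neighborFinset_eq_degree, neighborFinset_eq_filter]
  by_cases h : x = y
  · subst h
    simp [signlessLapMatrix, degMatrix, hdeg]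
  · simp [signlessLapMatrix, degMatrix, h]

theorem adjMatrix_nonneg {V : Type*} (G : SimpleGraph V) [DecidableRel G.Adj] (x y : V) :
    0 ≤ G.adjMatrix ℝ x y := by
  rw [adjMatrix_apply]; split_ifs <;> norm_num

theorem signlessLapMatrix_nonneg (G : SimpleGraph V) [DecidableRel G.Adj] (x y : V) :
    0 ≤ G.signlessLapMatrix x y := by
  rw [signlessLapMatrix_apply]
  split_ifs
  · exact Finset.sum_nonneg fun z _ => G.adjMatrix_nonneg x z
  · exact G.adjMatrix_nonneg x y

theorem signlessLapEstradaIndex_lt_of_lt {G H : SimpleGraph V} [DecidableRel G.Adj]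
    [DecidableRel H.Adj] (h : G < H) :
    G.signlessLapEstradaIndex < H.signlessLapEstradaIndex := by
  have hA : ∀ x y, G.adjMatrix ℝ x y ≤ H.adjMatrix ℝ x y := by
    intro x y
    rw [adjMatrix_apply, adjMatrix_apply]
    by_cases hG : G.Adj x y
    · simp [hG, h.le hG]
    · simpa [hG, adjMatrix_apply] using H.adjMatrix_nonneg x y
  refine Matrix.IsHermitian.sum_exp_eigenvalues_lt (H := 1) _ _ (by simp) (by simp)
    (fun x y => ?_) ?_
  · simp only [one_mul, mul_one]
    rw [abs_of_nonneg (G.signlessLapMatrix_nonneg x y), signlessLapMatrix_apply,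
      signlessLapMatrix_apply]
    split_ifs
    · exact Finset.sum_le_sum fun z _ => hA x z
    · exact hA x y
  · obtain ⟨x, y, hH, hG⟩ : ∃ x y, H.Adj x y ∧ ¬ G.Adj x y := by
      by_contra! hcon
      exact h.not_ge fun x y => hcon x y
    refine ⟨x, y, ?_⟩
    simp only [one_mul, mul_one]
    rw [abs_of_nonneg (G.signlessLapMatrix_nonneg x y), signlessLapMatrix_apply,
      signlessLapMatrix_apply, if_neg hH.ne, if_neg hH.ne]
    simp [hH, hG]

theorem Iso.signlessLapEstradaIndex_eq {W : Type*} [Fintype W] [DecidableEq W]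
    {G : SimpleGraph V} {H : SimpleGraph W} [DecidableRel G.Adj] [DecidableRel H.Adj]
    (e : G ≃g H) : G.signlessLapEstradaIndex = H.signlessLapEstradaIndex := by
  refine Matrix.IsHermitian.sum_exp_eigenvalues_submatrix _ _ e.toEquiv ?_
  ext x y
  have hA : ∀ x y, G.adjMatrix ℝ x y = H.adjMatrix ℝ (e x) (e y) := by
    intro x y
    simp only [adjMatrix_apply, e.map_adj_iff]
  rw [Matrix.submatrix_apply, signlessLapMatrix_apply, signlessLapMatrix_apply]
  simp only [hA, RelIso.coe_fn_toEquiv, EmbeddingLike.apply_eq_iff_eq]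
  congr 1
  exact Fintype.sum_equiv e.toEquiv _ _ fun _ => rfl

/-- At each other vertex z the transformation keeps A_az + A_bz and replaces A_az - A_bz by its
absolute value. The vertices u and w contribute differences of opposite sign, so the triangle
inequality for the degree difference is strict. -/
theorem signlessLapEstradaIndex_lt_kelmans {G K : SimpleGraph V} [DecidableRel G.Adj]
    [DecidableRel K.Adj] {a b : V} (hK : K = G.kelmans a b) (hab : a ≠ b) {u w : V} (hub : u ≠ b) (hau : G.Adj a u)
    (hbu : ¬ G.Adj b u) (hwa : w ≠ a) (hbw : G.Adj b w) (haw : ¬ G.Adj a w) :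
    G.signlessLapEstradaIndex < K.signlessLapEstradaIndex := by
  have hua : u ≠ a := hau.ne'
  have hwb : w ≠ b := hbw.ne'
  have hrest : ∀ x y, x ≠ a → x ≠ b → y ≠ a → y ≠ b →
      K.adjMatrix ℝ x y = G.adjMatrix ℝ x y := by
    intro x y hxa hxb hya hyb
    simp only [adjMatrix_apply, hK, kelmans_adj_of_ne hxa hxb hya hyb]
  have hadd : ∀ z, z ≠ a → z ≠ b → K.adjMatrix ℝ a z + K.adjMatrix ℝ b z =
      G.adjMatrix ℝ a z + G.adjMatrix ℝ b z := by
    intro z hza hzb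
    simp only [adjMatrix_apply, hK, kelmans_adj_left hab hza hzb, kelmans_adj_right hab hza hzb]
    by_cases h1 : G.Adj a z <;> by_cases h2 : G.Adj b z <;> simp [h1, h2]
  have hsub : ∀ z, z ≠ a → z ≠ b → |G.adjMatrix ℝ a z - G.adjMatrix ℝ b z| =
      K.adjMatrix ℝ a z - K.adjMatrix ℝ b z := by
    intro z hza hzb
    simp only [adjMatrix_apply, hK, kelmans_adj_left hab hza hzb, kelmans_adj_right hab hza hzb]
    by_cases h1 : G.Adj a z <;> by_cases h2 : G.Adj b z <;> simp [h1, h2]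
  have hpair : K.adjMatrix ℝ a b = G.adjMatrix ℝ a b := by
    simp only [adjMatrix_apply, hK, kelmans_adj_pair hab]
  have hsymm : ∀ (F : SimpleGraph V) [DecidableRel F.Adj] (x y : V),
      F.adjMatrix ℝ x y = F.adjMatrix ℝ y x := by
    intro F _ x y
    simp only [adjMatrix_apply, F.adj_comm]
  have hsum : ∀ (F : SimpleGraph V) [DecidableRel F.Adj] (x : V), ∑ z, F.adjMatrix ℝ x z =
      F.adjMatrix ℝ x a + F.adjMatrix ℝ x b + ∑ z ∈ {a, b}ᶜ, F.adjMatrix ℝ x z := by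
    intro F _ x
    rw [← Finset.sum_add_sum_compl {a, b}, Finset.sum_pair hab]
  have hself : ∀ (F : SimpleGraph V) [DecidableRel F.Adj] (x : V), F.adjMatrix ℝ x x = 0 := by
    intro F _ x
    simp
  have hmem : ∀ {z}, z ∈ ({a, b}ᶜ : Finset V) ↔ z ≠ a ∧ z ≠ b := by
    intro z
    simp
  refine Matrix.IsHermitian.sum_exp_eigenvalues_lt_of_pair _ _ hab G.signlessLapMatrix_nonneg
    ?_ ?_ ?_ ?_ ?_ ?_ ?_
  · intro x y hxa hxb hya hyb
    rw [signlessLapMatrix_apply, signlessLapMatrix_apply]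
    split_ifs
    · rw [hsum K, hsum G, hsymm K x a, hsymm K x b, hsymm G x a, hsymm G x b, hadd x hxa hxb]
      congr 1
      exact Finset.sum_congr rfl fun z hz => hrest x z hxa hxb (hmem.1 hz).1 (hmem.1 hz).2
    · exact hrest x y hxa hxb hya hyb
  · intro z hza hzb
    simp only [signlessLapMatrix_apply, if_neg hza.symm, if_neg hzb.symm]
    exact hadd z hza hzb
  · intro z hza hzb
    simp only [signlessLapMatrix_apply, if_neg hza.symm, if_neg hzb.symm]
    exact (hsub z hza hzb).le
  · simp only [signlessLapMatrix_apply, if_neg hab]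
    exact hpair
  · simp only [signlessLapMatrix_apply, if_true]
    rw [hsum K a, hsum K b, hsum G a, hsum G b, hsymm K b a, hsymm G b a, hpair]
    have := Finset.sum_congr rfl fun z (hz : z ∈ ({a, b}ᶜ : Finset V)) =>
      hadd z (hmem.1 hz).1 (hmem.1 hz).2
    rw [Finset.sum_add_distrib, Finset.sum_add_distrib] at this
    simp only [hself]
    linarith
  · simp only [signlessLapMatrix_apply, if_true]
    rw [hsum K a, hsum K b, hsum G a, hsum G b, hsymm K b a, hsymm G b a, hpair]
    have e : ∀ p s t : ℝ, 0 + p + s - (p + 0 + t) = s - t := fun p s t => by ring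
    simp only [hself, e, ← Finset.sum_sub_distrib]
    rw [abs_lt, ← Finset.sum_neg_distrib]
    constructor
    · refine Finset.sum_lt_sum (fun z hz => ?_) ⟨u, hmem.2 ⟨hua, hub⟩, ?_⟩
      · rw [← hsub z (hmem.1 hz).1 (hmem.1 hz).2]
        exact neg_abs_le _
      · rw [← hsub u hua hub]
        simp only [adjMatrix_apply, hau, hbu, if_true, if_false]
        norm_num
    · refine Finset.sum_lt_sum (fun z hz => ?_) ⟨w, hmem.2 ⟨hwa, hwb⟩, ?_⟩
      · rw [← hsub z (hmem.1 hz).1 (hmem.1 hz).2]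
        exact le_abs_self _
      · rw [← hsub w hwa hwb]
        simp only [adjMatrix_apply, hbw, haw, if_true, if_false]
        norm_num
  -- Diagonal dominance: each of the two degrees is at least the entry at (a, b).
  · simp only [signlessLapMatrix_apply, if_true, if_neg hab]
    rw [hsum G a, hsum G b, hsymm G b a]
    have h1 := Finset.sum_nonneg fun z (_ : z ∈ ({a, b}ᶜ : Finset V)) => G.adjMatrix_nonneg a z
    have h2 := Finset.sum_nonneg fun z (_ : z ∈ ({a, b}ᶜ : Finset V)) => G.adjMatrix_nonneg b z
    simp only [hself]
    linarith

end Spectral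

end SimpleGraph

namespace SimpleGraph

/-! ### Bridges as cuts with one crossing edge. -/

section CutFamilies

variable {V : Type*}

/-- The edge `p q` of `G` is the only one that joins `S` to its complement. -/
structure IsUniqueCrossing (G : SimpleGraph V) (S : Set V) (p q : V) : Prop where
  mem : p ∈ S
  notMem : q ∉ S
  adj : G.Adj p q
  unique : ∀ x y, x ∈ S → y ∉ S → G.Adj x y → x = p ∧ y = q

/-- `G` has `r` different bridges, `p i q i` being the only edge across the cut `S i`. -/
structure IsCutFamily (G : SimpleGraph V) {r : ℕ} (p q : Fin r → V) (S : Fin r → Set V) :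
    Prop where
  crossing : ∀ i, G.IsUniqueCrossing (S i) (p i) (q i)
  mem_iff : ∀ i j, i ≠ j → (p i ∈ S j ↔ q i ∈ S j)

theorem IsUniqueCrossing.compl {G : SimpleGraph V} {S : Set V} {p q : V}
    (h : G.IsUniqueCrossing S p q) : G.IsUniqueCrossing Sᶜ q p :=
  ⟨h.notMem, fun hp => hp h.mem, h.adj.symm, fun x y hx hy hxy =>
    (h.unique y x (not_not.1 hy) hx hxy.symm).symm⟩

theorem isUniqueCrossing_singleton {G : SimpleGraph V} {p q : V} (h : G.Adj p q)
    (hp : ∀ x, G.Adj p x → x = q) : G.IsUniqueCrossing {p} p q :=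
  ⟨rfl, fun hq => h.ne (Set.mem_singleton_iff.1 hq).symm, h, fun x y hx _ hxy => by
    obtain rfl := Set.mem_singleton_iff.1 hx
    exact ⟨rfl, hp y hxy⟩⟩

theorem IsCutFamily.eq_of_edge_eq {G : SimpleGraph V} {r : ℕ} {p q : Fin r → V}
    {S : Fin r → Set V} (h : G.IsCutFamily p q S) {i j : Fin r}
    (hij : s(p i, q i) = s(p j, q j)) : i = j := by
  by_contra hne
  have h1 := h.mem_iff i j hne
  have hp := (h.crossing j).mem
  have hq := (h.crossing j).notMem
  rcases Sym2.eq_iff.1 hij with ⟨e1, e2⟩ | ⟨e1, e2⟩ <;> rw [e1, e2] at h1 <;> tauto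

/-- Bridges that are the edges at different vertices of degree one. -/
theorem isCutFamily_of_leaves {G : SimpleGraph V} {r : ℕ} {p q : Fin r → V}
    (hadj : ∀ i, G.Adj (p i) (q i)) (hleaf : ∀ i x, G.Adj (p i) x → x = q i)
    (hp : Function.Injective p) (hq : ∀ i j, q i ≠ p j) :
    G.IsCutFamily p q fun i => {p i} :=
  ⟨fun i => isUniqueCrossing_singleton (hadj i) (hleaf i), fun i j hij =>
    iff_of_false (fun h => hij (hp h)) (hq i j)⟩

theorem exists_isCutFamily_of_ncard_cutEdges [Finite V] (G : SimpleGraph V) {r : ℕ}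
    (h : G.cutEdges.ncard = r) :
    ∃ (p q : Fin r → V) (S : Fin r → Set V), G.IsCutFamily p q S := by
  have hcard : Nat.card G.cutEdges = Nat.card (Fin r) := by
    rw [Nat.card_coe_set_eq, h, Nat.card_fin]
  let e : Fin r ≃ G.cutEdges := (Classical.choice (Finite.card_eq.1 hcard)).symm
  have key : ∀ i, ∃ (p q : V) (S : Set V), (e i : Sym2 V) = s(p, q) ∧
      G.IsUniqueCrossing S p q := by
    intro i
    obtain ⟨f, hf, hb⟩ := e i
    induction f with | h p q => ?_
    -- The cut is the component of p once the bridge is deleted.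
    refine ⟨p, q, {x | (G.deleteEdges {s(p, q)}).Reachable p x}, rfl, Reachable.refl p, hb, hf,
      fun x y hx hy hxy => ?_⟩
    by_cases he : s(x, y) = s(p, q)
    · rcases Sym2.eq_iff.1 he with h | ⟨rfl, rfl⟩
      · exact h
      · exact absurd hx hb
    · refine absurd (Reachable.trans hx (Adj.reachable ?_)) hy
      rw [deleteEdges_adj]
      exact ⟨hxy, he⟩
  choose p q S hpq hS using key
  refine ⟨p, q, S, hS, fun i j hij => ?_⟩
  by_contra hcon
  -- A bridge with ends on both sides of the cut `S j` must be its only crossing edge.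
  have hedge : s(p i, q i) = s(p j, q j) := by
    by_cases hp : p i ∈ S j
    · have hq : q i ∉ S j := fun hq => hcon (iff_of_true hp hq)
      obtain ⟨h1, h2⟩ := (hS j).unique _ _ hp hq (hS i).adj
      rw [h1, h2]
    · have hq : q i ∈ S j := by
        by_contra hq
        exact hcon (iff_of_false hp hq)
      obtain ⟨h1, h2⟩ := (hS j).unique _ _ hq hp (hS i).adj.symm
      rw [h1, h2, Sym2.eq_swap]
  rw [← hpq, ← hpq] at hedge
  exact hij (e.injective (Subtype.ext hedge))

-- A crossing edge at b moves to a. None can remain at b, since it would come from two crossing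
-- edges, one at a and one at b.
open Classical in
theorem IsUniqueCrossing.kelmans {G : SimpleGraph V} {S : Set V} {p q a b : V}
    (h : G.IsUniqueCrossing S p q) (hab : a ≠ b) (hS : a ∈ S ↔ b ∈ S) :
    (G.kelmans a b).IsUniqueCrossing S (if p = b then a else p) (if q = b then a else q) := by
  wlog ha : a ∈ S generalizing S p q
  · simpa using (this h.compl (not_congr hS) ha).compl
  have hb : b ∈ S := hS.1 ha
  have hqa : q ≠ a := fun hq => h.notMem (hq ▸ ha)
  have hqb : q ≠ b := fun hq => h.notMem (hq ▸ hb)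
  have hout : ∀ y, y ∉ S → y ≠ a ∧ y ≠ b := fun y hy =>
    ⟨fun e => hy (e ▸ ha), fun e => hy (e ▸ hb)⟩
  rw [if_neg hqb]
  refine ⟨?_, h.notMem, ?_, fun x y hx hy hxy => ?_⟩
  · split_ifs
    · exact ha
    · exact h.mem
  · have := h.adj
    by_cases hpb : p = b
    · rw [if_pos hpb, kelmans_adj_left hab hqa hqb]
      exact Or.inr (hpb ▸ this)
    · rw [if_neg hpb]
      by_cases hpa : p = a
      · subst hpa
        exact (kelmans_adj_left hab hqa hqb).2 (Or.inl this)
      · exact (kelmans_adj_of_ne hpa hpb hqa hqb).2 this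
  · obtain ⟨hya, hyb⟩ := hout y hy
    by_cases hxa : x = a
    · subst hxa
      rcases (kelmans_adj_left hab hya hyb).1 hxy with hadj | hadj
      · obtain ⟨h1, h2⟩ := h.unique _ _ hx hy hadj
        exact ⟨by rw [← h1, if_neg hab], h2⟩
      · obtain ⟨h1, h2⟩ := h.unique _ _ hb hy hadj
        exact ⟨by rw [← h1, if_pos rfl], h2⟩
    · by_cases hxb : x = b
      · subst hxb
        obtain ⟨h1, h2⟩ := (kelmans_adj_right hab hya hyb).1 hxy
        exact absurd ((h.unique _ _ ha hy h1).1.trans (h.unique _ _ hx hy h2).1.symm) hab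
      · obtain ⟨h1, h2⟩ := h.unique _ _ hx hy ((kelmans_adj_of_ne hxa hxb hya hyb).1 hxy)
        exact ⟨by rw [← h1, if_neg hxb], h2⟩

open Classical in
theorem IsCutFamily.kelmans {G : SimpleGraph V} {r : ℕ} {p q : Fin r → V} {S : Fin r → Set V}
    (h : G.IsCutFamily p q S) {a b : V} (hab : a ≠ b) (hS : ∀ i, a ∈ S i ↔ b ∈ S i) :
    (G.kelmans a b).IsCutFamily (fun i => if p i = b then a else p i)
      (fun i => if q i = b then a else q i) S := by
  refine ⟨fun i => (h.crossing i).kelmans hab (hS i), fun i j hij => ?_⟩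
  have := h.mem_iff i j hij
  have := hS j
  split_ifs <;> simp_all

open Classical in
/-- The Kelmans transformation along a bridge turns it into a pendent edge and keeps the other
bridges. -/
theorem IsCutFamily.kelmans_bridge {G : SimpleGraph V} {r : ℕ} {p q : Fin r → V}
    {S : Fin r → Set V} (h : G.IsCutFamily p q S) (k : Fin r) :
    ∃ (p' q' : Fin r → V) (S' : Fin r → Set V),
      (G.kelmans (p k) (q k)).IsCutFamily p' q' S' := by
  set a := p k with ha
  set b := q k with hb
  have hk := h.crossing k
  rw [← ha, ← hb] at hk
  have hab : a ≠ b := hk.adj.ne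
  have hπ : ∀ x, (if x = b then a else x) ≠ b := by
    intro x
    split_ifs with hx
    · exact hab
    · exact hx
  -- The bridge k gets the cut {b}: a common neighbour of a and b would bypass the bridge, so b
  -- keeps only a. The relabelled ends of the other bridges avoid b by `hπ`.
  refine ⟨fun i => if i = k then b else if p i = b then a else p i,
    fun i => if i = k then a else if q i = b then a else q i,
    fun i => if i = k then {b} else S i, fun i => ?_, fun i j hij => ?_⟩
  · by_cases hik : i = k
    · simp only [hik, if_true]
      refine isUniqueCrossing_singleton ((kelmans_adj_pair hab).2 hk.adj).symm fun x hx => ?_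
      by_contra hxa
      obtain ⟨h1, h2⟩ := (kelmans_adj_right hab hxa hx.ne').1 hx
      by_cases hxS : x ∈ S k
      · exact hxa (hk.unique x b hxS hk.notMem h2.symm).1
      · exact hx.ne' (hk.unique a x hk.mem hxS h1).2
    · simp only [hik, if_false]
      exact (h.crossing i).kelmans hab (h.mem_iff k i (Ne.symm hik))
  · by_cases hjk : j = k
    · have hik : i ≠ k := hjk ▸ hij
      simp only [hjk, hik, if_true, if_false, Set.mem_singleton_iff]
      exact iff_of_false (hπ _) (hπ _)
    · have hS := h.mem_iff k j (Ne.symm hjk)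
      rw [← ha, ← hb] at hS
      have := h.mem_iff i j hij
      simp only [hjk, if_false]
      split_ifs <;> simp_all

end CutFamilies

/-! ### Structure of the maximizers. -/

section Maximizers

variable {V : Type*} [Fintype V] [DecidableEq V]

open Classical in
/-- Among the graphs with at least `r` bridges, `G` has the largest signless Laplacian Estrada
index. -/
def IsCutMaximizer (G : SimpleGraph V) (r : ℕ) : Prop :=
  ∀ (H : SimpleGraph V) (p q : Fin r → V) (S : Fin r → Set V), H.IsCutFamily p q S →
    H.signlessLapEstradaIndex ≤ G.signlessLapEstradaIndex

variable {G : SimpleGraph V} {r : ℕ} {p q : Fin r → V} {S : Fin r → Set V}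

/-- Otherwise both ends have further neighbours, unshared because a bridge lies in no triangle, and
transforming along the bridge raises the index. -/
theorem IsCutMaximizer.exists_leaf (hG : G.IsCutMaximizer r) (h : G.IsCutFamily p q S)
    (k : Fin r) : (∀ x, G.Adj (p k) x → x = q k) ∨ (∀ x, G.Adj (q k) x → x = p k) := by
  classical
  by_contra! hcon
  obtain ⟨⟨u, hu, huq⟩, ⟨w, hw, hwp⟩⟩ := hcon
  have hk := h.crossing k
  obtain ⟨p', q', S', h'⟩ := h.kelmans_bridge k
  have hno : ∀ z, G.Adj (p k) z → ¬ G.Adj (q k) z := by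
    intro z h1 h2
    by_cases hz : z ∈ S k
    · exact h1.ne' (hk.unique z _ hz hk.notMem h2.symm).1
    · exact h2.ne' (hk.unique _ z hk.mem hz h1).2
  exact (hG _ _ _ _ h').not_gt (signlessLapEstradaIndex_lt_kelmans rfl hk.adj.ne huq hu (hno u hu)
    hwp hw fun h1 => hno w h1 hw)

/-- Each bridge is oriented from a leaf. If the centre of one were the leaf of another, the two
would be the same edge. -/
theorem IsCutMaximizer.exists_leaves (hG : G.IsCutMaximizer r) (h : G.IsCutFamily p q S) :
    ∃ p' q' : Fin r → V, (∀ i, G.Adj (p' i) (q' i)) ∧ (∀ i x, G.Adj (p' i) x → x = q' i) ∧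
      Function.Injective p' ∧ ∀ i j, q' i ≠ p' j := by
  have key : ∀ k, ∃ a b, G.Adj a b ∧ s(a, b) = s(p k, q k) ∧ ∀ x, G.Adj a x → x = b := by
    intro k
    rcases hG.exists_leaf h k with hk | hk
    · exact ⟨p k, q k, (h.crossing k).adj, rfl, hk⟩
    · exact ⟨q k, p k, (h.crossing k).adj.symm, Sym2.eq_swap, hk⟩
  choose a b hadj hab hleaf using key
  refine ⟨a, b, hadj, hleaf, fun i j hij => ?_, fun i j hij => ?_⟩
  · have hb : b i = b j := hleaf j _ (hij ▸ hadj i)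
    exact h.eq_of_edge_eq (by rw [← hab, ← hab, hij, hb])
  · have ha : a i = b j := hleaf j _ (hij ▸ (hadj i).symm)
    have : i = j := h.eq_of_edge_eq (by rw [← hab, ← hab, hij, ha, Sym2.eq_swap])
    subst this
    exact (hadj i).ne hij.symm

/-- A new edge between non-leaves keeps the pendent edges pendent. -/
theorem IsCutMaximizer.adj_of_not_leaf (hG : G.IsCutMaximizer r)
    (hadj : ∀ i, G.Adj (p i) (q i)) (hleaf : ∀ i x, G.Adj (p i) x → x = q i)
    (hp : Function.Injective p) (hq : ∀ i j, q i ≠ p j) {u v : V} (hu : u ∉ Set.range p)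
    (hv : v ∉ Set.range p) (huv : u ≠ v) : G.Adj u v := by
  classical
  by_contra hcon
  obtain ⟨K, hK⟩ : ∃ K, K = G ⊔ edge u v := ⟨_, rfl⟩
  have h : K.IsCutFamily p q fun i => {p i} := by
    subst hK
    refine isCutFamily_of_leaves (fun i => Or.inl (hadj i)) (fun i x hx => ?_) hp hq
    rcases hx with hx | hx
    · exact hleaf i x hx
    · rcases ((edge_adj ..).1 hx).1 with ⟨h, -⟩ | ⟨h, -⟩
      · exact absurd ⟨i, h⟩ hu
      · exact absurd ⟨i, h⟩ hv
  exact (hG _ _ _ _ h).not_gt (signlessLapEstradaIndex_lt_of_lt (hK ▸ lt_sup_edge G u v huv hcon))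

/-- Singleton cuts at leaves do not separate two centres, and distinct centres have unshared leaves,
so the transformation would apply and raise the index. -/
theorem IsCutMaximizer.center_eq (hG : G.IsCutMaximizer r)
    (hadj : ∀ i, G.Adj (p i) (q i)) (hleaf : ∀ i x, G.Adj (p i) x → x = q i)
    (hp : Function.Injective p) (hq : ∀ i j, q i ≠ p j) (i j : Fin r) : q i = q j := by
  classical
  by_contra hij
  have h := (isCutFamily_of_leaves hadj hleaf hp hq).kelmans hij fun k =>
    iff_of_false (hq i k) (hq j k)
  refine (hG _ _ _ _ h).not_gt (signlessLapEstradaIndex_lt_kelmans rfl hij (u := p i) (w := p j)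
    (fun e => hq j i e.symm) (hadj i).symm (fun e => hij ?_) (fun e => hq i j e.symm)
    (hadj j).symm fun e => hij ?_)
  · exact (hleaf i _ e.symm).symm
  · exact hleaf j _ e.symm

theorem nonempty_iso_completeWithPendents {n : ℕ} (hr : r < n) (hcard : Fintype.card V = n)
    (hadj : ∀ i, G.Adj (p i) (q i)) (hleaf : ∀ i x, G.Adj (p i) x → x = q i)
    (hp : Function.Injective p) (hq : ∀ i j, q i ≠ p j) (hqq : ∀ i j, q i = q j)
    (hclique : ∀ u v, u ∉ Set.range p → v ∉ Set.range p → u ≠ v → G.Adj u v) :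
    Nonempty (G ≃g completeWithPendents n r) := by
  classical
  have hrange : Fintype.card {x // x ∈ Set.range p} = r := by
    rw [← Fintype.card_congr (Equiv.ofInjective p hp), Fintype.card_fin]
  have hcompl : Fintype.card {x // x ∉ Set.range p} = n - r := by
    rw [Fintype.card_subtype_compl, hrange, hcard]
  have hfin : Fintype.card {i : Fin n // ¬ i.val + r < n} = r := by
    have h1 : Fintype.card {i : Fin n // i.val + r < n} = n - r := by
      rw [Fintype.card_subtype]
      have : (Finset.univ.filter fun i : Fin n => i.val + r < n) =
          Finset.univ.filter fun i : Fin n => i.val < n - r := by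
        ext i; simp; omega
      rw [this, Fin.card_filter_val_lt]
      omega
    rw [Fintype.card_subtype_compl, h1, Fintype.card_fin]
    omega
  have hfin' : Fintype.card {i : Fin n // ¬ ¬ i.val + r < n} = n - r := by
    rw [Fintype.card_subtype_compl, hfin, Fintype.card_fin]
  obtain ⟨c, hc, hqc⟩ : ∃ c, c ∉ Set.range p ∧ ∀ i, q i = c := by
    -- With no pendent edges, any vertex can serve as the centre.
    rcases Nat.eq_zero_or_pos r with h0 | h0
    · subst h0
      have : 0 < Fintype.card {x // x ∉ Set.range p} := by omega
      obtain ⟨⟨c, hc⟩⟩ := Fintype.card_pos_iff.1 this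
      exact ⟨c, hc, fun i => i.elim0⟩
    · refine ⟨q ⟨0, h0⟩, ?_, fun i => hqq _ _⟩
      rintro ⟨j, hj⟩
      exact hq _ j hj.symm
  let f : {x // x ∈ Set.range p} ≃ {i : Fin n // ¬ i.val + r < n} :=
    Fintype.equivOfCardEq (hrange.trans hfin.symm)
  let g₀ : {x // x ∉ Set.range p} ≃ {i : Fin n // ¬ ¬ i.val + r < n} :=
    Fintype.equivOfCardEq (hcompl.trans hfin'.symm)
  let z : {i : Fin n // ¬ ¬ i.val + r < n} := ⟨⟨0, by omega⟩, by simpa using hr⟩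
  -- The swap makes the centre go to the vertex 0.
  let g := g₀.trans (Equiv.swap (g₀ ⟨c, hc⟩) z)
  have hgc : g ⟨c, hc⟩ = z := by simp [g]
  let e : V ≃ Fin n := (Equiv.sumCompl (· ∈ Set.range p)).symm.trans
    ((Equiv.sumCongr f g).trans (Equiv.sumCompl fun i : Fin n => ¬ i.val + r < n))
  have he1 : ∀ x (hx : x ∈ Set.range p), e x = f ⟨x, hx⟩ := by
    intro x hx
    simp [e, Equiv.sumCompl_symm_apply_of_pos (p := (· ∈ Set.range p)) hx]
  have he2 : ∀ x (hx : x ∉ Set.range p), e x = g ⟨x, hx⟩ := by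
    intro x hx
    simp [e, Equiv.sumCompl_symm_apply_of_neg (p := (· ∈ Set.range p)) hx]
  have hlt : ∀ x, (e x).val + r < n ↔ x ∉ Set.range p := by
    intro x
    by_cases hx : x ∈ Set.range p
    · rw [he1 x hx]
      exact iff_of_false (f ⟨x, hx⟩).2 (not_not.2 hx)
    · rw [he2 x hx]
      exact iff_of_true (not_not.1 (g ⟨x, hx⟩).2) hx
  have hec : (e c).val = 0 := by rw [he2 c hc, hgc]
  have hzero : ∀ x, (e x).val = 0 ↔ x = c := by
    intro x
    rw [← hec, ← Fin.ext_iff, e.injective.eq_iff]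
  have hmemadj : ∀ x y, x ∈ Set.range p → (G.Adj x y ↔ y = c) := by
    rintro _ y ⟨i, rfl⟩
    constructor
    · intro h; rw [hleaf i y h, hqc]
    · rintro rfl; rw [← hqc i]; exact hadj i
  refine ⟨⟨e, fun {x y} => ?_⟩⟩
  change (e x ≠ e y ∧ _) ↔ _
  simp only [← not_lt, hlt, hzero, e.injective.ne_iff]
  by_cases hx : x ∈ Set.range p <;> by_cases hy : y ∈ Set.range p
  · have : x ≠ c := fun h => hc (h ▸ hx)
    have : y ≠ c := fun h => hc (h ▸ hy)
    have := hmemadj x y hx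
    tauto
  · have : x ≠ c := fun h => hc (h ▸ hx)
    have : x ≠ y := fun h => hy (h ▸ hx)
    have := hmemadj x y hx
    tauto
  · have : y ≠ c := fun h => hc (h ▸ hy)
    have : x ≠ y := fun h => hx (h ▸ hy)
    have := hmemadj y x hy
    have := G.adj_comm x y
    tauto
  · have h1 := hclique x y hx hy
    have h2 : G.Adj x y → x ≠ y := fun h => h.ne
    tauto

theorem IsCutMaximizer.nonempty_iso {n : ℕ} (hG : G.IsCutMaximizer r) (h : G.IsCutFamily p q S)
    (hr : r < n) (hcard : Fintype.card V = n) : Nonempty (G ≃g completeWithPendents n r) := by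
  obtain ⟨p', q', hadj, hleaf, hp, hq⟩ := hG.exists_leaves h
  exact nonempty_iso_completeWithPendents hr hcard hadj hleaf hp hq
    (hG.center_eq hadj hleaf hp hq) fun u v hu hv huv =>
      hG.adj_of_not_leaf hadj hleaf hp hq hu hv huv

open Classical in
theorem exists_isCutMaximizer (h : G.IsCutFamily p q S) :
    ∃ (H : SimpleGraph V) (p' q' : Fin r → V) (S' : Fin r → Set V),
      H.IsCutFamily p' q' S' ∧ H.IsCutMaximizer r := by
  obtain ⟨H, ⟨p', q', S', hH⟩, hmax⟩ := Set.exists_max_image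
    {H : SimpleGraph V | ∃ (p q : Fin r → V) (S : Fin r → Set V), H.IsCutFamily p q S}
    (fun H => H.signlessLapEstradaIndex) (Set.toFinite _) ⟨G, p, q, S, h⟩
  exact ⟨H, p', q', S', hH, fun K p q S hK => hmax K ⟨p, q, S, hK⟩⟩

end Maximizers

end SimpleGraph

theorem mainTheorem1 {V : Type*} [Fintype V] [DecidableEq V] (n r : ℕ) (hr : r + 3 ≤ n)
    (G : SimpleGraph V) [DecidableRel G.Adj] (hcard : Fintype.card V = n) (hconn : G.Connected)
    (hcut : G.cutEdges.ncard = r) :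
    G.signlessLapEstradaIndex ≤ (SimpleGraph.completeWithPendents n r).signlessLapEstradaIndex ∧
      (G.signlessLapEstradaIndex =
          (SimpleGraph.completeWithPendents n r).signlessLapEstradaIndex ↔
        Nonempty (G ≃g SimpleGraph.completeWithPendents n r)) := by
  classical
  obtain ⟨p, q, S, hG⟩ := G.exists_isCutFamily_of_ncard_cutEdges hcut
  obtain ⟨H, p', q', S', hH, hmax⟩ := SimpleGraph.exists_isCutMaximizer hG
  obtain ⟨e⟩ := hmax.nonempty_iso hH (by omega) hcard
  have he := e.signlessLapEstradaIndex_eq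
  have hle := hmax G p q S hG
  refine ⟨?_, fun heq => ?_, fun ⟨f⟩ => f.signlessLapEstradaIndex_eq⟩
  · rw [← he]
    convert hle
  -- Equality makes G itself a maximizer, so the structure result applies to it directly.
  · refine SimpleGraph.IsCutMaximizer.nonempty_iso (fun K p q S hK => ?_) hG (by omega) hcard
    refine (hmax K p q S hK).trans (le_of_eq ?_)
    convert (heq.trans he.symm).symm
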